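/- For an infinite cardinal $\theta$ let $H_\theta$ be the collection of all sets whose transitive closure has cardinality less than $\theta$. For sets $M,N$ whose intersections with $\omega_1$ are transitive, write $M\sqsubset N$ if $M\subsetneq N$ and $M\cap\omega_1=N\cap\omega_1$. Strong Chang's Conjecture (SCC) is the statement: for all sufficiently large regular cardinals $\theta$, all wellorders $\Delta$ of $H_\theta$, and all countable $M\prec(H_\theta,\in,\Delta)$, there exists $\widetilde M\prec(H_\theta,\in,\Delta)$ such that $M\sqsubset\widetilde M$ and $\widetilde M\cap[\sup(M\cap\omega_2),\omega_2)\neq\emptyset$. An Aronszajn tree on $\omega_2$ is a tree (a partial order in which the set of predecessors of each node is well ordered) of height $\omega_2$, all of whose levels have size at most $\aleph_1$, and which has no branch meeting every level below $\omega_2$. Such a tree is special if it is the union of $\omega_1$ many antichains. **Theorem.** If the Continuum Hypothesis fails and SCC holds, then there are no special Aronszajn trees on $\omega_2$. -/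

import Mathlib

open scoped Cardinal Ordinal

universe u

namespace StrongChang

/-! ### The structures `(H_θ, ∈, Δ)` -/

/-- `H_θ`, the class of sets whose transitive closure has size less than `θ`. (The transitive
closure of `x` is the least transitive superset of `x`, so it has size `< θ` iff some transitive
superset of `x` has.) -/
def H (θ : Cardinal.{u}) : Set ZFSet.{u} :=
  {x | ∃ y : ZFSet.{u}, y.IsTransitive ∧ x ⊆ y ∧ y.card < θ}

/-- The two binary relation symbols of the structures `(H_θ, ∈, Δ)`. -/
inductive SetOrderRel : ℕ → Type
  | mem : SetOrderRel 2
  | ord : SetOrderRel 2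

/-- The first-order language with two binary relation symbols, for `∈` and `Δ`. -/
def setOrderLang : FirstOrder.Language.{0, 0} :=
  ⟨fun _ => Empty, SetOrderRel⟩

/-- The universe of the structure `(H_θ, ∈, Δ)`. -/
def HModel (θ : Cardinal.{u}) (_Δ : H θ → H θ → Prop) : Type (u + 1) :=
  H θ

/-- The structure `(H_θ, ∈, Δ)`, where `Δ x y` means that `x` is `Δ`-before `y`. -/
instance hStructure (θ : Cardinal.{u}) (Δ : H θ → H θ → Prop) :
    setOrderLang.Structure (HModel θ Δ) where
  funMap := fun f => nomatch f
  RelMap := fun r =>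
    match r with
    | SetOrderRel.mem => fun v : Fin 2 → H θ => (v 0 : ZFSet.{u}) ∈ (v 1 : ZFSet.{u})
    | SetOrderRel.ord => fun v : Fin 2 → H θ => Δ (v 0) (v 1)

/-- `M ≺ (H_θ, ∈, Δ)`: the set `M` is the universe of an elementary substructure of
`(H_θ, ∈, Δ)`. -/
def IsElementary (M : Set ZFSet.{u}) (θ : Cardinal.{u}) (Δ : H θ → H θ → Prop) : Prop :=
  ∃ S : setOrderLang.ElementarySubstructure (HModel θ Δ),
    M = (Subtype.val : H θ → ZFSet.{u}) '' {x : H θ | (show HModel θ Δ from x) ∈ S}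

/-! ### Strong Chang's Conjecture -/

/-- `M ∩ γ`, regarded as a set of ordinals. -/
def ordTrace (M : Set ZFSet.{u}) (γ : Ordinal.{u}) : Set Ordinal.{u} :=
  {α | α < γ ∧ α.toZFSet ∈ M}

/-- `M ⊏ N`: both `M` and `N` have transitive intersection with `ω₁`, `M` is a proper subset of
`N`, and `M ∩ ω₁ = N ∩ ω₁`. -/
def EndExtends (M N : Set ZFSet.{u}) : Prop :=
  IsLowerSet (ordTrace M ω₁) ∧ IsLowerSet (ordTrace N ω₁) ∧
    M ⊂ N ∧ ordTrace M ω₁ = ordTrace N ω₁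

/-- Strong Chang's Conjecture: for all sufficiently large regular `θ`, all wellorders `Δ` of `H_θ`,
and all countable `M ≺ (H_θ, ∈, Δ)`, there is `N ≺ (H_θ, ∈, Δ)` such that `M ⊏ N` and
`N ∩ [sup (M ∩ ω₂), ω₂)` is nonempty. -/
def SCC : Prop :=
  ∃ κ : Cardinal.{u}, ∀ θ : Cardinal.{u}, κ ≤ θ → θ.IsRegular →
    ∀ Δ : H θ → H θ → Prop, IsWellOrder (H θ) Δ →
      ∀ M : Set ZFSet.{u}, M.Countable → IsElementary M θ Δ →
        ∃ N : Set ZFSet.{u}, IsElementary N θ Δ ∧ EndExtends M N ∧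
          ∃ β ∈ ordTrace N (ω_ 2), sSup (ordTrace M (ω_ 2)) ≤ β

/-! ### Special Aronszajn trees on `ω₂` -/

/-- A (set-theoretic) tree: a partial order in which the predecessors of each node are
well ordered. -/
class IsSetTree (T : Type u) [PartialOrder T] : Prop where
  isWellOrder_Iio : ∀ t : T, IsWellOrder (Set.Iio t) (· < ·)

attribute [instance] IsSetTree.isWellOrder_Iio

/-- The height of a node: the order type of its set of predecessors. -/
noncomputable def nodeHeight {T : Type u} [PartialOrder T] [IsSetTree T] (t : T) : Ordinal.{u} :=
  Ordinal.type (fun a b : Set.Iio t => a < b)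

/-- The `α`-th level of a tree. -/
def level (T : Type u) [PartialOrder T] [IsSetTree T] (α : Ordinal.{u}) : Set T :=
  {t | nodeHeight t = α}

/-- An Aronszajn tree on `ω₂`: a tree of height `ω₂` all of whose levels have size at most `ℵ₁`,
with no cofinal branch, i.e. no chain meeting all levels below `ω₂`. -/
structure IsAronszajnTree (T : Type u) [PartialOrder T] [IsSetTree T] : Prop where
  height_lt : ∀ t : T, nodeHeight t < ω_ 2
  level_nonempty : ∀ α : Ordinal.{u}, α < ω_ 2 → (level T α).Nonempty
  level_small : ∀ α : Ordinal.{u}, α < ω_ 2 → #(level T α) ≤ ℵ₁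
  no_branch : ¬ ∃ b : Set T, IsChain (· ≤ ·) b ∧
    ∀ α : Ordinal.{u}, α < ω_ 2 → (b ∩ level T α).Nonempty

/-- A tree (on `ω₂`) is special if it is the union of `ω₁` many antichains. -/
def IsSpecial (T : Type u) [PartialOrder T] : Prop :=
  ∃ A : Set.Iio (ω₁ : Ordinal.{u}) → Set T,
    (∀ i, IsAntichain (· ≤ ·) (A i)) ∧ ⋃ i, A i = Set.univ

end StrongChang

namespace StrongChang

open FirstOrder Language

/-! ### Elementary submodels generated by sets of parameters -/

/-! Suppose `T` is a special Aronszajn tree, with labels `e, f` below `ω₁`, where `e` is injective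
on levels and `f` on chains. Choose `t β` on level `β`, let `s α β` be its predecessor on level `α`,
and put `h α β = max (e (s α β)) (f (s α β))`.

For `x : ℕ → Bool` let `M x` be the countable Skolem hull of a code for `h` and of ordinals `β x n`
with supremum `ν`. A game argument (`exists_splitting_family`) provides one `δ < ω₁` bounding every
trace `M x ∩ ω₁`, and `exists_perfect_tree` gives all branches the same `ν`. SCC extends `M x` to a
model with the same trace that contains some `B x ≥ ν`. That model is closed under `h`, so `h (β x
n) (B x) < δ` for all `n`.

The nodes `s ν (B x)` on level `ν` are pairwise distinct. Where `x` and `y` first differ, the two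
moves are chosen to conflict (`exists_conflict`): a node on the higher level with `e < δ` has its
predecessor on the lower level coloured `≥ δ` by `f`. If `s ν (B x) = s ν (B y)`, the nodes below it
on these two levels would violate this. Hence level `ν` has `2^ℵ₀` nodes, but at most `ℵ₁`, which is
CH. -/

instance : Countable (Σ l, setOrderLang.Functions l) :=
  have : IsEmpty (Σ l, setOrderLang.Functions l) := ⟨fun f => nomatch f.2⟩
  inferInstance

theorem card_setOrderLang_le : setOrderLang.card ≤ ℵ₀ := by
  have h1 : Countable (Σ l, setOrderLang.Relations l) := by
    refine Function.Injective.countable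
      (f := fun r : (Σ l, setOrderLang.Relations l) =>
        match r with
        | ⟨_, SetOrderRel.mem⟩ => true
        | ⟨_, SetOrderRel.ord⟩ => false) ?_
    rintro ⟨_, _ | _⟩ ⟨_, _ | _⟩ h <;> simp_all
  have : Countable setOrderLang.Symbols := by unfold Language.Symbols; infer_instance
  exact Cardinal.mk_le_aleph0

/-- The set `p`, regarded as a subset of the structure `(H_θ, ∈, Δ)`. -/
def toModel (θ : Cardinal.{u}) (Δ : H θ → H θ → Prop) (p : Set ZFSet.{u}) : Set (HModel θ Δ) :=
  {y | (show H θ from y).val ∈ p}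

/-- The Skolem hull of `p` in `(H_θ, ∈, Δ)`, as a substructure for the Skolemized language. -/
noncomputable def skolemHull (θ : Cardinal.{u}) (Δ : H θ → H θ → Prop) [Nonempty (HModel θ Δ)]
    (p : Set ZFSet.{u}) : (setOrderLang.sum setOrderLang.skolem₁).Substructure (HModel θ Δ) :=
  Substructure.closure _ (toModel θ Δ p)

/-- The Skolem hull of `p` in `(H_θ, ∈, Δ)`, as a set of sets. -/
noncomputable def hull (θ : Cardinal.{u}) (Δ : H θ → H θ → Prop) [Nonempty (HModel θ Δ)]
    (p : Set ZFSet.{u}) : Set ZFSet.{u} :=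
  (Subtype.val : H θ → ZFSet.{u}) '' {x : H θ | (show HModel θ Δ from x) ∈ skolemHull θ Δ p}

section Hull

variable {θ : Cardinal.{u}} {Δ : H θ → H θ → Prop} [Nonempty (HModel θ Δ)]

theorem isElementary_hull (p : Set ZFSet.{u}) : IsElementary (hull θ Δ p) θ Δ :=
  ⟨(skolemHull θ Δ p).elementarySkolem₁Reduct, rfl⟩

theorem countable_hull {p : Set ZFSet.{u}} (hp : p.Countable) : (hull θ Δ p).Countable := by
  have h1 : Countable (Σ l, (setOrderLang.sum setOrderLang.skolem₁).Functions l) :=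
    Cardinal.mk_le_aleph0_iff.1
      (card_functions_sum_skolem₁_le.trans (max_le le_rfl card_setOrderLang_le))
  have h2 : (toModel θ Δ p).Countable := hp.preimage Subtype.val_injective
  have h3 := h2.substructure_closure (setOrderLang.sum setOrderLang.skolem₁)
  have h4 : (skolemHull θ Δ p : Set (HModel θ Δ)).Countable := Set.countable_coe_iff.1 h3
  exact h4.image _

theorem hull_mono {p q : Set ZFSet.{u}} (h : p ⊆ q) : hull θ Δ p ⊆ hull θ Δ q := by
  refine Set.image_mono fun x hx => ?_
  exact Substructure.closure_mono (L := setOrderLang.sum setOrderLang.skolem₁)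
    (s := toModel θ Δ p) (t := toModel θ Δ q) (fun y hy => h hy) hx

theorem subset_hull {p : Set ZFSet.{u}} {x : ZFSet.{u}} (hx : x ∈ p) (hH : x ∈ H θ) :
    x ∈ hull θ Δ p :=
  ⟨⟨x, hH⟩, Substructure.subset_closure (L := setOrderLang.sum setOrderLang.skolem₁)
    (M := HModel θ Δ) (s := toModel θ Δ p) hx, rfl⟩

/-- Skolem functions are finitary, so a member of the hull needs only finitely many generators. This
carries a bound on traces from finite positions to a whole branch. -/
theorem mem_hull_iUnion {p : ℕ → Set ZFSet.{u}} (hp : Monotone p) {x : ZFSet.{u}}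
    (hx : x ∈ hull θ Δ (⋃ n, p n)) : ∃ n, x ∈ hull θ Δ (p n) := by
  obtain ⟨y, hy, rfl⟩ := hx
  suffices h : ∃ n, (show HModel θ Δ from y) ∈ skolemHull θ Δ (p n) from
    h.imp fun n hn => ⟨y, hn, rfl⟩
  refine Substructure.closure_induction (p := fun y => ∃ n, y ∈ skolemHull θ Δ (p n)) hy ?_ ?_
  · intro z hz
    obtain ⟨n, hn⟩ := Set.mem_iUnion.1 hz
    exact ⟨n, Substructure.subset_closure (L := setOrderLang.sum setOrderLang.skolem₁) hn⟩
  · intro n f x hx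
    choose m hm using hx
    refine ⟨Finset.univ.sup m, (skolemHull θ Δ _).fun_mem f x fun i => ?_⟩
    exact Substructure.closure_mono (L := setOrderLang.sum setOrderLang.skolem₁)
      (s := toModel θ Δ (p (m i)))
      (fun y hy => hp (Finset.le_sup (Finset.mem_univ i)) hy) (hm i)

end Hull

/-- The relation symbol for membership. -/
def memRel : setOrderLang.Relations 2 := SetOrderRel.mem

/-- The formula `∃ z x, z ∈ g ∧ x ∈ z ∧ a ∈ z ∧ b ∈ z ∧ x ∈ a` in the parameters `g, a, b`. -/
def tripleFormula : setOrderLang.Formula (Fin 3) :=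
  let v : Fin 3 → setOrderLang.Term (Fin 3 ⊕ Fin 2) := fun i => Term.var (Sum.inl i)
  let z : setOrderLang.Term (Fin 3 ⊕ Fin 2) := Term.var (Sum.inr 0)
  let x : setOrderLang.Term (Fin 3 ⊕ Fin 2) := Term.var (Sum.inr 1)
  BoundedFormula.ex (BoundedFormula.ex
    (memRel.boundedFormula₂ z (v 0) ⊓ (memRel.boundedFormula₂ x z ⊓
      (memRel.boundedFormula₂ (v 1) z ⊓
        (memRel.boundedFormula₂ (v 2) z ⊓ memRel.boundedFormula₂ x (v 1))))))

theorem realize_tripleFormula {M : Type*} [setOrderLang.Structure M] (w : Fin 3 → M) :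
    tripleFormula.Realize w ↔ ∃ z x : M,
      Structure.RelMap memRel ![z, w 0] ∧ Structure.RelMap memRel ![x, z] ∧
        Structure.RelMap memRel ![w 1, z] ∧ Structure.RelMap memRel ![w 2, z] ∧
          Structure.RelMap memRel ![x, w 1] := by
  simp only [tripleFormula, Formula.Realize, BoundedFormula.realize_ex, BoundedFormula.realize_inf,
    BoundedFormula.realize_rel₂, Term.realize_var, Sum.elim_inl, Sum.elim_inr]
  rfl

theorem IsElementary.exists_triple {M : Set ZFSet.{u}} {θ : Cardinal.{u}} {Δ : H θ → H θ → Prop}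
    (hM : IsElementary M θ Δ) {g a b z x : ZFSet.{u}} (hg : g ∈ M) (ha : a ∈ M) (hb : b ∈ M)
    (hz : z ∈ H θ) (hx : x ∈ H θ) (hzg : z ∈ g) (hxz : x ∈ z) (haz : a ∈ z) (hbz : b ∈ z)
    (hxa : x ∈ a) : ∃ z' ∈ g, ∃ x' ∈ z', x' ∈ M ∧ a ∈ z' ∧ b ∈ z' ∧ x' ∈ a := by
  obtain ⟨S, rfl⟩ := hM
  obtain ⟨g, hgS, rfl⟩ := hg
  obtain ⟨a, haS, rfl⟩ := ha
  obtain ⟨b, hbS, rfl⟩ := hb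
  let w : Fin 3 → S := ![⟨g, hgS⟩, ⟨a, haS⟩, ⟨b, hbS⟩]
  have h1 : tripleFormula.Realize (S.subtype ∘ w) := by
    rw [realize_tripleFormula]
    exact ⟨(⟨z, hz⟩ : H θ), (⟨x, hx⟩ : H θ), hzg, hxz, haz, hbz, hxa⟩
  rw [S.subtype.map_formula, realize_tripleFormula] at h1
  obtain ⟨z', x', h1, h2, h3, h4, h5⟩ := h1
  exact ⟨(show H θ from z'.1).val, h1, (show H θ from x'.1).val, h2, ⟨x'.1, x'.2, rfl⟩, h3, h4, h5⟩

end StrongChang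

namespace StrongChang

open Set

/-! ### Bounded sets of ordinals -/

theorem exists_bound_of_card_le {s : Set Ordinal.{u}} (hs : #s ≤ ℵ₁) (h : ∀ x ∈ s, x < ω_ 2) :
    ∃ β < ω_ 2, ∀ x ∈ s, x < β := by
  have hreg : (ℵ_ (2 : Ordinal.{u})).IsRegular := by
    simpa [one_add_one_eq_two] using Cardinal.isRegular_aleph_add_one (1 : Ordinal.{u})
  have hlim : Order.IsSuccLimit (ω_ (2 : Ordinal.{u})) := Cardinal.isSuccLimit_omega 2
  refine ⟨⨆ x : s, (x.1 + 1), ?_, fun x hx => ?_⟩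
  · refine Ordinal.lift_iSup_lt_of_lt_cof ?_ fun x => hlim.add_one_lt (h x x.2)
    have h1 : (ω_ (2 : Ordinal.{u})).cof = ℵ_ 2 := by rw [← Cardinal.ord_aleph, hreg.cof_ord]
    have h2 : Cardinal.lift.{u} #s ≤ ℵ₁ := by simpa using hs
    refine h2.trans_lt ?_
    rw [← Ordinal.lift_cof, h1, Cardinal.lift_aleph]
    simp
  · have hb : BddAbove (range fun x : s => x.1 + 1) :=
      ⟨ω_ 2, by rintro _ ⟨x, rfl⟩; exact (hlim.add_one_lt (h x x.2)).le⟩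
    exact (lt_add_one x).trans_le (le_ciSup hb ⟨x, hx⟩)

theorem card_range_Iio_omega_one_le (g : Ordinal.{u} → Ordinal.{u}) :
    #(g '' Iio ω₁) ≤ ℵ₁ := by
  refine Cardinal.mk_image_le.trans ?_
  rw [Cardinal.mk_Iio_ordinal]
  simp

theorem exists_bound_of_countable {s : Set Ordinal.{u}} (hs : s.Countable)
    (h : ∀ x ∈ s, x < ω₁) : ∃ δ < ω₁, ∀ x ∈ s, x < δ := by
  have hlim : Order.IsSuccLimit (ω₁ : Ordinal.{u}) := Cardinal.isSuccLimit_omega 1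
  have := hs.to_subtype
  refine ⟨⨆ x : s, (x.1 + 1), Ordinal.iSup_lt_omega_one fun x => hlim.add_one_lt (h x x.2),
    fun x hx => ?_⟩
  have hb : BddAbove (range fun x : s => x.1 + 1) :=
    ⟨ω₁, by rintro _ ⟨x, rfl⟩; exact (hlim.add_one_lt (h x x.2)).le⟩
  exact (lt_add_one x).trans_le (le_ciSup hb ⟨x, hx⟩)

theorem countable_Iio_of_lt {δ : Ordinal.{u}} (hδ : δ < ω₁) : (Iio δ).Countable := by
  rw [← Cardinal.le_aleph0_iff_set_countable, Cardinal.mk_Iio_ordinal]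
  have h := Cardinal.lt_omega_iff_card_lt.1 hδ
  rw [← Cardinal.succ_aleph0, Order.lt_succ_iff] at h
  exact Cardinal.lift_le_aleph0.2 h

/-- An unbounded subset of `ω₂` has an element below which it is uncountable. -/
theorem exists_uncountable_below {U : Set Ordinal.{u}} (hU : ∀ x ∈ U, x < ω_ 2)
    (hunb : ∀ α < ω_ 2, ∃ β ∈ U, α < β) : ∃ b ∈ U, ¬ {a ∈ U | a < b}.Countable := by
  have h1 : ¬ #U ≤ ℵ₁ := fun h => by
    obtain ⟨β, hβ, h⟩ := exists_bound_of_card_le h hU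
    obtain ⟨x, hx, hxβ⟩ := hunb β hβ
    exact (h x hx).not_gt hxβ
  -- Any `ℵ₁` members of `U` are bounded in `ω₂`; `b` is taken above that bound.
  obtain ⟨V, hVU, hV⟩ := Cardinal.le_mk_iff_exists_subset.1 (not_le.1 h1).le
  obtain ⟨β, hβ, h⟩ := exists_bound_of_card_le hV.le fun x hx => hU x (hVU hx)
  obtain ⟨b, hb, hbβ⟩ := hunb β hβ
  refine ⟨b, hb, fun hc => ?_⟩
  have h2 : V.Countable := hc.mono fun x hx => show x ∈ U ∧ x < b from ⟨hVU hx, (h x hx).trans hbβ⟩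
  rw [← Cardinal.le_aleph0_iff_set_countable, hV] at h2
  exact h2.not_gt Cardinal.aleph0_lt_aleph_one

/-! ### The game -/

/-- Strategies for the player who plays lower bounds in the game on `ω₂`. -/
inductive Strategy : Type (u + 1)
  | halt : Strategy
  | play (α : Ordinal.{u}) (next : Ordinal.{u} → Strategy) : Strategy

instance : Inhabited Strategy.{u} := ⟨.halt⟩

/-- The lower bound played by a strategy. -/
noncomputable def Strategy.bound : Strategy.{u} → Ordinal.{u}
  | halt => 0
  | play α _ => α

/-- The strategy in the position after the answer `β`. -/
def Strategy.answer : Strategy.{u} → Ordinal.{u} → Strategy.{u}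
  | halt, _ => halt
  | play _ next, β => next β

variable (K : Set Ordinal.{u} → Set Ordinal.{u})

/-- The strategy `σ`, followed from the position `p`, leads to a position `q` with
`K q ⊈ δ` after finitely many rounds. -/
def Strategy.Wins (δ : Ordinal.{u}) : Set Ordinal.{u} → Strategy.{u} → Prop
  | p, halt => ¬ K p ⊆ Iio δ
  | p, play α next => α < ω_ 2 ∧ ∀ β, α < β → β < ω_ 2 → Strategy.Wins δ (insert β p) (next β)

variable {K}

theorem Strategy.Wins.bound_lt {δ : Ordinal.{u}} {p : Set Ordinal.{u}} {σ : Strategy.{u}}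
    (h : σ.Wins K δ p) : σ.bound < ω_ 2 := by
  cases σ with
  | halt => exact Ordinal.omega_pos 2
  | play α next => exact h.1

/-- A halted strategy stays halted, and monotonicity of `K` preserves its win as the position grows.
-/
theorem Strategy.Wins.answer (hK : Monotone K) {δ : Ordinal.{u}} {p : Set Ordinal.{u}}
    {σ : Strategy.{u}} (h : σ.Wins K δ p) {β : Ordinal.{u}} (hb : σ.bound < β) (hβ : β < ω_ 2) :
    (σ.answer β).Wins K δ (insert β p) := by
  cases σ with
  | halt => exact fun h' => h ((hK (subset_insert _ _)).trans h')
  | play α next => exact h.2 β hb hβ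

/-- A family `σ δ`, `δ < ω₁`, of strategies that win from the position `p`. -/
structure WinningFamily (K : Set Ordinal.{u} → Set Ordinal.{u}) where
  pos : Set Ordinal.{u}
  strat : Ordinal.{u} → Strategy.{u}
  wins : ∀ δ < ω₁, (strat δ).Wins K δ pos

theorem WinningFamily.exists_answer (x : WinningFamily K) :
    ∃ β < ω_ 2, ∀ δ < ω₁, (x.strat δ).bound < β := by
  obtain ⟨β, hβ, h⟩ := exists_bound_of_card_le
    (card_range_Iio_omega_one_le fun δ => (x.strat δ).bound)
    (by rintro _ ⟨δ, hδ, rfl⟩; exact (x.wins δ hδ).bound_lt)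
  exact ⟨β, hβ, fun δ hδ => h _ ⟨δ, hδ, rfl⟩⟩

/-- The answer to all strategies of the family simultaneously. -/
noncomputable def WinningFamily.reply (x : WinningFamily K) : Ordinal.{u} :=
  x.exists_answer.choose

/-- The family after one round. -/
noncomputable def WinningFamily.next (hK : Monotone K) (x : WinningFamily K) : WinningFamily K where
  pos := insert x.reply x.pos
  strat δ := (x.strat δ).answer x.reply
  wins δ hδ := (x.wins δ hδ).answer hK (x.exists_answer.choose_spec.2 δ hδ)
    x.exists_answer.choose_spec.1

/-- If every `δ < ω₁` had a winning strategy, all `ω₁` of them could be answered simultaneously,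
since `ω₁` many bounds have a common bound below `ω₂`. After `ω` rounds `K` is still countable,
hence inside some `δ`, and the strategy for this `δ` has failed. -/
theorem exists_not_wins (hK : Monotone K) (hlt : ∀ p, K p ⊆ Iio ω₁)
    (hc : ∀ p : Set Ordinal.{u}, p.Countable → (K p).Countable) :
    ∃ δ < ω₁, ∀ σ : Strategy.{u}, ¬ σ.Wins K δ ∅ := by
  by_contra! hcon
  choose! σ hσ using hcon
  let st : ℕ → WinningFamily K := fun n => (WinningFamily.next hK)^[n] ⟨∅, σ, hσ⟩
  have st_succ : ∀ n, st (n + 1) = (st n).next hK := fun n =>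
    Function.iterate_succ_apply' _ _ _
  have hcount : ∀ n, (st n).pos.Countable := by
    intro n
    induction n with
    | zero => exact countable_empty
    | succ n ih => rw [st_succ]; exact ih.insert _
  obtain ⟨δ, hδ, hb⟩ := exists_bound_of_countable (hc _ (countable_iUnion hcount))
    (fun x hx => hlt _ hx)
  -- Strategies are well-founded trees, so the play against the strategy for `δ` would have to halt;
  -- halting requires `K` to leave `δ`.
  have key : ∀ (τ : Strategy.{u}) (n : ℕ), (st n).strat δ ≠ τ := by
    intro τ
    induction τ with
    | halt =>
      intro n h
      have hw := (st n).wins δ hδ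
      rw [h] at hw
      exact hw fun x hx => hb x (hK (subset_iUnion (fun n => (st n).pos) n) hx)
    | play α next ih =>
      intro n h
      refine ih (st n).reply (n + 1) ?_
      rw [st_succ]
      change ((st n).strat δ).answer (st n).reply = next (st n).reply
      rw [h]
      rfl
  exact key _ 0 rfl

/-- A family of positions in which the next element can be chosen arbitrarily large below `ω₂`,
while `K` remains bounded by a fixed countable ordinal. -/
theorem exists_splitting_family (hK : Monotone K) (hlt : ∀ p, K p ⊆ Iio ω₁)
    (hc : ∀ p : Set Ordinal.{u}, p.Countable → (K p).Countable) :
    ∃ δ < ω₁, ∃ W : Set (Set Ordinal.{u}), ∅ ∈ W ∧ (∀ p ∈ W, K p ⊆ Iio δ) ∧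
      ∀ p ∈ W, ∀ α < ω_ 2, ∃ β < ω_ 2, α < β ∧ insert β p ∈ W := by
  obtain ⟨δ, hδ, h⟩ := exists_not_wins hK hlt hc
  refine ⟨δ, hδ, {p | ∀ σ : Strategy.{u}, ¬ σ.Wins K δ p}, h, fun p hp => ?_, fun p hp α hα => ?_⟩
  · by_contra hcon
    exact hp .halt hcon
  -- Open determinacy: if all replies above `α` could be won, playing `α` would already win at `p`.
  · by_contra! hcon
    simp only [mem_ofPred_eq, not_forall, not_not] at hcon
    choose! next hnext using hcon
    exact hp (.play α next) ⟨hα, fun β h1 h2 => hnext β h2 h1⟩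

/-! ### A perfect tree of generators -/

/-- The first `n` bits of `x`, the last one first. -/
def initialBits (x : ℕ → Bool) : ℕ → List Bool
  | 0 => []
  | n + 1 => x n :: initialBits x n

theorem exists_initialBits_eq {x y : ℕ → Bool} (h : x ≠ y) :
    ∃ n, initialBits x n = initialBits y n ∧ x n ≠ y n := by
  classical
  have hex : ∃ n, x n ≠ y n := by
    by_contra! hcon
    exact h (funext hcon)
  refine ⟨Nat.find hex, ?_, Nat.find_spec hex⟩
  have hlt : ∀ m < Nat.find hex, x m = y m := fun m hm => not_not.1 (Nat.find_min hex hm)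
  generalize Nat.find hex = n at hlt
  induction n with
  | zero => rfl
  | succ n ih =>
    rw [initialBits, initialBits, ih fun m hm => hlt m (hm.trans n.lt_succ_self),
      hlt n n.lt_succ_self]

/-- In a family `W` in which all positions split, there is a perfect tree of branches all of whose
generators have the same supremum. -/
theorem exists_perfect_tree {W : Set (Set Ordinal.{u})} {R : Ordinal.{u} → Ordinal.{u} → Prop}
    (h0 : ∅ ∈ W) (hW : ∀ p ∈ W, ∀ α < ω_ 2, ∃ a b, α < a ∧ α < b ∧ a < ω_ 2 ∧ b < ω_ 2 ∧
      R a b ∧ insert a p ∈ W ∧ insert b p ∈ W) {α₀ : Ordinal.{u}} (hα₀ : α₀ < ω_ 2) :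
    ∃ (β : (ℕ → Bool) → ℕ → Ordinal.{u}) (ν : Ordinal.{u}), ν < ω_ 2 ∧
      (∀ x n, α₀ < β x n ∧ β x n < ν) ∧
      (∀ x, ∀ ν' < ν, ∃ n, ν' < β x n) ∧
      (∀ x n, β x '' Iio n ∈ W) ∧
      ∀ x y, x ≠ y → ∃ n, R (β x n) (β y n) ∨ R (β y n) (β x n) := by
  choose! A B hαA hαB hA hB hR hAW hBW using hW
  let C : Bool → Set Ordinal.{u} → Ordinal.{u} → Ordinal.{u} := fun c => bif c then B else A
  have hC : ∀ c, ∀ p ∈ W, ∀ α < ω_ 2, α < C c p α ∧ C c p α < ω_ 2 ∧ insert (C c p α) p ∈ W := by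
    rintro (_ | _) p hp α hα
    · exact ⟨hαA p hp α hα, hA p hp α hα, hAW p hp α hα⟩
    · exact ⟨hαB p hp α hα, hB p hp α hα, hBW p hp α hα⟩
  -- A stage has only countably many candidate moves, so one ordinal exceeds them all. These bounds
  -- do not depend on the branch, whence the common supremum.
  have hbound : ∀ s : {s : Ordinal.{u} × (List Bool → Set Ordinal.{u}) //
      s.1 < ω_ 2 ∧ ∀ l, s.2 l ∈ W}, ∃ α < ω_ 2, ∀ l c, C c (s.1.2 l) s.1.1 < α := by
    rintro ⟨⟨α, P⟩, hα, hP⟩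
    obtain ⟨α', hα', h⟩ := exists_bound_of_card_le
      (s := range fun q : List Bool × Bool => C q.2 (P q.1) α)
      ((countable_range _).le_aleph0.trans (Cardinal.aleph0_le_aleph 1))
      (by rintro _ ⟨q, rfl⟩; exact (hC q.2 _ (hP q.1) α hα).2.1)
    exact ⟨α', hα', fun l c => h _ ⟨(l, c), rfl⟩⟩
  choose bd hbd hbd' using hbound
  -- At stage `n` only lists of length `n` carry meaningful positions; the others, such as `∅` at
  -- the empty list, are fillers from `W`.
  let next : {s : Ordinal.{u} × (List Bool → Set Ordinal.{u}) // s.1 < ω_ 2 ∧ ∀ l, s.2 l ∈ W} →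
      {s : Ordinal.{u} × (List Bool → Set Ordinal.{u}) // s.1 < ω_ 2 ∧ ∀ l, s.2 l ∈ W} := fun s =>
    ⟨(bd s, fun l => l.rec ∅ fun c l _ => insert (C c (s.1.2 l) s.1.1) (s.1.2 l)), hbd s, by
      rintro (_ | ⟨c, l⟩)
      · exact h0
      · exact (hC c _ (s.2.2 l) _ s.2.1).2.2⟩
  let st := fun n : ℕ => next^[n] ⟨(α₀, fun _ => ∅), hα₀, fun _ => h0⟩
  have st_succ : ∀ n, st (n + 1) = next (st n) := fun n => Function.iterate_succ_apply' _ _ _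
  let β : (ℕ → Bool) → ℕ → Ordinal.{u} := fun x n =>
    C (x n) ((st n).1.2 (initialBits x n)) (st n).1.1
  have hβ : ∀ x n, (st n).1.1 < β x n := fun x n => (hC _ _ ((st n).2.2 _) _ (st n).2.1).1
  have hβ' : ∀ x n, β x n < (st (n + 1)).1.1 := fun x n => by
    rw [st_succ]; exact hbd' (st n) _ _
  have hmono : ∀ n, α₀ ≤ (st n).1.1 := by
    intro n
    induction n with
    | zero => exact le_rfl
    | succ n ih => exact ih.trans ((hβ (fun _ => true) n).trans (hβ' (fun _ => true) n)).le
  have hpos : ∀ x n, (st n).1.2 (initialBits x n) = β x '' Iio n := by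
    intro x n
    induction n with
    | zero => simp [st, initialBits]
    | succ n ih =>
      have hI : Iio (n + 1) = insert n (Iio n) := by ext m; simp
      rw [st_succ, hI, image_insert_eq, ← ih]
      rfl
  obtain ⟨ν₀, hν₀, hν₀'⟩ := exists_bound_of_card_le (s := range fun n => (st n).1.1)
    ((countable_range _).le_aleph0.trans (Cardinal.aleph0_le_aleph 1))
    (by rintro _ ⟨n, rfl⟩; exact (st n).2.1)
  have hbdd : BddAbove (range fun n => (st n).1.1) := ⟨ν₀, fun x hx => (hν₀' x hx).le⟩
  refine ⟨β, ⨆ n, (st n).1.1, (ciSup_le' fun n => (hν₀' _ ⟨n, rfl⟩).le).trans_lt hν₀,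
    fun x n => ⟨(hmono n).trans_lt (hβ x n), (hβ' x n).trans_le (le_ciSup hbdd (n + 1))⟩,
    fun x ν' h => ?_, fun x n => ?_, fun x y hxy => ?_⟩
  · obtain ⟨n, hn⟩ := exists_lt_of_lt_ciSup h
    exact ⟨n, hn.trans (hβ x n)⟩
  · rw [← hpos]
    exact (st n).2.2 _
  · obtain ⟨n, hn, hne⟩ := exists_initialBits_eq hxy
    refine ⟨n, ?_⟩
    have hr := hR _ ((st n).2.2 (initialBits x n)) _ (st n).2.1
    simp only [β, ← hn]
    revert hne
    cases x n <;> cases y n <;> intro hne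
    · exact (hne rfl).elim
    · exact Or.inl hr
    · exact Or.inr hr
    · exact (hne rfl).elim

end StrongChang

namespace StrongChang

open Set

/-! ### Trees -/

section Tree

variable {T : Type u} [PartialOrder T] [IsSetTree T]

theorem nodeHeight_eq_typein {s t : T} (h : s < t) :
    nodeHeight s = Ordinal.typein (fun a b : Iio t => a < b) ⟨s, h⟩ := by
  rw [← Ordinal.type_subrel]
  refine Ordinal.type_eq.2 ⟨⟨⟨fun a => ⟨⟨a.1, a.2.trans h⟩, a.2⟩, fun a => ⟨a.1.1, a.2⟩,
    fun a => rfl, fun a => rfl⟩, Iff.rfl⟩⟩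

theorem nodeHeight_strictMono : StrictMono (nodeHeight : T → Ordinal.{u}) := fun s t h => by
  rw [nodeHeight_eq_typein h]
  exact Ordinal.typein_lt_type _ _

theorem exists_le_nodeHeight_eq {t : T} {α : Ordinal.{u}} (h : α ≤ nodeHeight t) :
    ∃ s ≤ t, nodeHeight s = α := by
  rcases h.eq_or_lt with rfl | h
  · exact ⟨t, le_rfl, rfl⟩
  · obtain ⟨s, hs⟩ := Ordinal.typein_surj (fun a b : Iio t => a < b) h
    exact ⟨s.1, le_of_lt s.2, (nodeHeight_eq_typein s.2).trans hs⟩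

theorem le_of_nodeHeight_le {q r t : T} (hq : q ≤ t) (hr : r ≤ t)
    (h : nodeHeight q ≤ nodeHeight r) : q ≤ r := by
  rcases hr.eq_or_lt with rfl | hr
  · exact hq
  rcases hq.eq_or_lt with rfl | hq
  · exact ((nodeHeight_strictMono hr).not_ge h).elim
  by_contra hcon
  rcases (IsSetTree.isWellOrder_Iio t).toTrichotomous.rel_or_eq_or_rel_swap
    (a := ⟨q, hq⟩) (b := ⟨r, hr⟩) with h' | h' | h'
  · exact hcon (le_of_lt h')
  · exact hcon (Subtype.ext_iff.1 h').le
  · exact (nodeHeight_strictMono (show r < q from h')).not_ge h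

/-- A special Aronszajn tree has labellings `e, f` by countable ordinals, where `e` is injective on
levels and `f` is injective on chains. -/
theorem IsAronszajnTree.exists_labels (hT : IsAronszajnTree T) (hS : IsSpecial T) :
    ∃ e f : T → Ordinal.{u}, (∀ t, e t < ω₁) ∧ (∀ t, f t < ω₁) ∧
      (∀ s t, nodeHeight s = nodeHeight t → e s = e t → s = t) ∧
      ∀ s t, s ≤ t → f s = f t → s = t := by
  have h1 : ∀ α : Ordinal.{u}, α < ω_ 2 →
      Nonempty (level T α ↪ Iio (ω₁ : Ordinal.{u})) := fun α hα => by
    rw [← Cardinal.lift_mk_le', Cardinal.mk_Iio_ordinal]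
    have h2 := Cardinal.lift_le.{u + 1}.2 (hT.level_small α hα)
    simpa using h2
  let E := fun α hα => Classical.choice (h1 α hα)
  obtain ⟨A, hA, hAu⟩ := hS
  have h3 : ∀ t, ∃ i, t ∈ A i := fun t => mem_iUnion.1 (hAu ▸ mem_univ t)
  choose i hi using h3
  refine ⟨fun t => (E _ (hT.height_lt t) ⟨t, rfl⟩).1, fun t => (i t).1, fun t => (E _ (hT.height_lt t) ⟨t, rfl⟩).2,
    fun t => (i t).2, fun s t h h' => ?_, fun s t h h' => ?_⟩
  · have key : ∀ α (hα : α < ω_ 2) (x y : level T α), (E α hα x).1 = (E α hα y).1 → x.1 = y.1 :=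
      fun α hα x y hxy => congrArg _ ((E α hα).injective (Subtype.ext hxy))
    have key' : ∀ α (hα : α < ω_ 2) (hs : nodeHeight s = α),
        (E α hα ⟨s, hs⟩).1 = (E _ (hT.height_lt s) ⟨s, rfl⟩).1 := by
      rintro _ _ rfl
      rfl
    exact key _ (hT.height_lt t) ⟨s, h⟩ ⟨t, rfl⟩ ((key' _ (hT.height_lt t) h).trans h')
  · have h4 : i s = i t := Subtype.ext h'
    exact (hA (i t)).eq (h4 ▸ hi s) (hi t) h

/-- `a` and `b` conflict if every node on level `b` with label below `δ` lies above a node on level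
`a` with colour at least `δ`. -/
def Conflict (e f : T → Ordinal.{u}) (δ a b : Ordinal.{u}) : Prop :=
  ∀ t, nodeHeight t = b → e t < δ → ∀ s ≤ t, nodeHeight s = a → δ ≤ f s

variable {e f : T → Ordinal.{u}}

/-- Level `b` has countably many nodes with label below `δ`, and below each of them lie countably
many nodes with colour below `δ`. -/
theorem countable_not_conflict (he : ∀ s t, nodeHeight s = nodeHeight t → e s = e t → s = t)
    (hf : ∀ s t, s ≤ t → f s = f t → s = t) {δ : Ordinal.{u}} (hδ : δ < ω₁) (b : Ordinal.{u}) :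
    {a | ¬ Conflict e f δ a b}.Countable := by
  have h1 : {t : T | nodeHeight t = b ∧ e t < δ}.Countable :=
    MapsTo.countable_of_injOn (f := e) (t := Iio δ) (fun t ht => ht.2)
      (fun s hs t ht h => he s t (hs.1.trans ht.1.symm) h) (countable_Iio_of_lt hδ)
  have h2 : ∀ t : T, {s | s ≤ t ∧ f s < δ}.Countable := fun t =>
    MapsTo.countable_of_injOn (f := f) (t := Iio δ) (fun s hs => hs.2)
      (fun s hs s' hs' h => by
        rcases le_total (nodeHeight s) (nodeHeight s') with hle | hle
        · exact hf _ _ (le_of_nodeHeight_le hs.1 hs'.1 hle) h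
        · exact (hf _ _ (le_of_nodeHeight_le hs'.1 hs.1 hle) h.symm).symm)
      (countable_Iio_of_lt hδ)
  refine (h1.biUnion fun t _ => (h2 t).image nodeHeight).mono fun a ha => ?_
  simp only [Conflict, mem_ofPred_eq, not_forall, not_le] at ha
  obtain ⟨t, ht, het, s, hst, hs, hfs⟩ := ha
  exact mem_biUnion (x := t) ⟨ht, het⟩ ⟨s, ⟨hst, hfs⟩, hs⟩

theorem exists_conflict (he : ∀ s t, nodeHeight s = nodeHeight t → e s = e t → s = t)
    (hf : ∀ s t, s ≤ t → f s = f t → s = t) {δ : Ordinal.{u}} (hδ : δ < ω₁)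
    {U : Set Ordinal.{u}} (hU : ∀ x ∈ U, x < ω_ 2) (hunb : ∀ α < ω_ 2, ∃ β ∈ U, α < β) :
    ∃ a ∈ U, ∃ b ∈ U, a < b ∧ Conflict e f δ a b := by
  obtain ⟨b, hb, hunc⟩ := exists_uncountable_below hU hunb
  by_contra! hcon
  exact hunc ((countable_not_conflict he hf hδ b).mono fun a ha => hcon a ha.1 b hb ha.2)

end Tree

/-! ### Coding a function by a set -/

/-- A binary function on `[ω₁, ω₂)` with values below `ω₁` can be coded by a set `g` such that
elementary submodels containing `g` are closed under the function. -/
theorem exists_code (h : Ordinal.{u} → Ordinal.{u} → Ordinal.{u})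
    (hh : ∀ α β, α < β → β < ω_ 2 → h α β < ω₁) :
    ∃ (κ : Cardinal.{u}) (g : ZFSet.{u}), ∀ θ, κ ≤ θ → g ∈ H θ ∧
      (∀ α < ω_ 2, α.toZFSet ∈ H θ) ∧
      ∀ (Δ : H θ → H θ → Prop) (N : Set ZFSet.{u}), IsElementary N θ Δ → g ∈ N →
        ∀ α β, ω₁ ≤ α → α < β → β < ω_ 2 → α.toZFSet ∈ N → β.toZFSet ∈ N →
          (h α β).toZFSet ∈ N := by
  let I := {p : Ordinal.{u} × Ordinal.{u} // ω₁ ≤ p.1 ∧ p.1 < p.2 ∧ p.2 < ω_ 2}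
  have hsmall : Small.{u} I :=
    small_of_injective (β := Iio (ω_ 2 : Ordinal.{u}) × Iio (ω_ 2 : Ordinal.{u}))
      (f := fun p => (⟨p.1.1, p.2.2.1.trans p.2.2.2⟩, ⟨p.1.2, p.2.2.2⟩)) fun p q hpq => by
        simp only [Prod.mk.injEq] at hpq
        exact Subtype.ext (Prod.ext (congrArg Subtype.val hpq.1) (congrArg Subtype.val hpq.2))
  -- Unordered triples suffice: as `h α β < ω₁ ≤ α < β`, the entries are told apart by size, and `h
  -- α β` is the only one that is a member of `α`.
  let g : ZFSet.{u} := ZFSet.range fun p : I =>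
    ({(h p.1.1 p.1.2).toZFSet, p.1.1.toZFSet, p.1.2.toZFSet} : ZFSet.{u})
  let y : ZFSet.{u} := ZFSet.vonNeumann (max g.rank (ω_ 2) + 1)
  have hy : y.IsTransitive := ZFSet.isTransitive_vonNeumann _
  have hgy : g ∈ y := ZFSet.mem_vonNeumann.2 (Order.lt_add_one_iff.2 (le_max_left _ _))
  refine ⟨Order.succ y.card, g, fun θ hθ => ?_⟩
  have hH : ∀ x ∈ y, x ∈ H θ := fun x hx =>
    ⟨y, hy, hy x hx, (Order.lt_succ _).trans_le hθ⟩
  have hord : ∀ α < ω_ 2, α.toZFSet ∈ H θ := fun α hα =>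
    hH _ (ZFSet.mem_vonNeumann.2 (by
      rw [Ordinal.rank_toZFSet]
      exact Order.lt_add_one_iff.2 (hα.le.trans (le_max_right _ _))))
  refine ⟨hH _ hgy, hord, fun Δ N hN hgN α β hα hαβ hβ hαN hβN => ?_⟩
  have hz : ({(h α β).toZFSet, α.toZFSet, β.toZFSet} : ZFSet.{u}) ∈ g :=
    ZFSet.mem_range.2 ⟨⟨(α, β), hα, hαβ, hβ⟩, rfl⟩
  have hlt := hh α β hαβ hβ
  obtain ⟨z, hz, x, hxz, hxN, haz, hbz, hxa⟩ := hN.exists_triple hgN hαN hβN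
    (hH _ (hy _ hgy hz)) (hord _ ((hlt.trans_le hα).trans (hαβ.trans hβ))) hz
    (x := (h α β).toZFSet) (by simp) (by simp) (by simp)
    (Ordinal.toZFSet_mem_toZFSet_iff.2 (hlt.trans_le hα))
  obtain ⟨⟨⟨α', β'⟩, hα', hαβ', hβ'⟩, rfl⟩ := ZFSet.mem_range.1 hz
  have hlt' := hh α' β' hαβ' hβ'
  simp only [ZFSet.mem_insert_iff, ZFSet.mem_singleton, Ordinal.toZFSet_injective.eq_iff]
    at hxz haz hbz
  dsimp only at hα' hαβ'
  have h1 : β = β' ∧ α = α' := by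
    rcases hbz with rfl | rfl | rfl
    · exact ((hα.trans hαβ.le).not_gt hlt').elim
    · rcases haz with rfl | rfl | rfl
      · exact (hα.not_gt hlt').elim
      · exact hαβ.false.elim
      · exact (hαβ.not_gt hαβ').elim
    · rcases haz with rfl | rfl | rfl
      · exact (hα.not_gt hlt').elim
      · exact ⟨rfl, rfl⟩
      · exact hαβ.false.elim
  obtain ⟨rfl, rfl⟩ := h1
  rcases hxz with rfl | rfl | rfl
  · exact hxN
  · exact ((Ordinal.toZFSet_mem_toZFSet_iff.1 hxa).false).elim
  · exact ((Ordinal.toZFSet_mem_toZFSet_iff.1 hxa).not_gt hαβ).elim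

/-! ### Strong Chang's Conjecture and perfect trees of models -/

theorem countable_ordTrace {M : Set ZFSet.{u}} (hM : M.Countable) (γ : Ordinal.{u}) :
    (ordTrace M γ).Countable :=
  (hM.preimage Ordinal.toZFSet_injective).mono fun _ hα => hα.2

/-- Under Strong Chang's Conjecture, a function `h` from pairs of ordinals below `ω₂` to `ω₁` is
bounded by a fixed `δ < ω₁` on the generators of a perfect tree of models, each of them paired with
one ordinal above their common supremum. The relation `R` makes different branches diverge. -/
theorem SCC.exists_perfect_tree (hSCC : SCC.{u}) {h : Ordinal.{u} → Ordinal.{u} → Ordinal.{u}}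
    (hh : ∀ α β, α < β → β < ω_ 2 → h α β < ω₁)
    {R : Ordinal.{u} → Ordinal.{u} → Ordinal.{u} → Prop}
    (hR : ∀ δ < ω₁, ∀ U : Set Ordinal.{u}, (∀ x ∈ U, x < ω_ 2) →
      (∀ α < ω_ 2, ∃ β ∈ U, α < β) → ∃ a ∈ U, ∃ b ∈ U, R δ a b) :
    ∃ δ < ω₁, ∃ (β : (ℕ → Bool) → ℕ → Ordinal.{u}) (B : (ℕ → Bool) → Ordinal.{u})
      (ν : Ordinal.{u}), ν < ω_ 2 ∧ (∀ x n, β x n < ν) ∧ (∀ x, ν ≤ B x ∧ B x < ω_ 2) ∧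
        (∀ x n, h (β x n) (B x) < δ) ∧
        ∀ x y, x ≠ y → ∃ n, R δ (β x n) (β y n) ∨ R δ (β y n) (β x n) := by
  obtain ⟨κ, hκ⟩ := hSCC
  obtain ⟨κ', g, hg⟩ := exists_code h hh
  let θ : Cardinal.{u} := Order.succ (max (max κ κ') ℵ₀)
  have hθκ : κ ≤ θ := ((le_max_left _ _).trans (le_max_left _ _)).trans (Order.le_succ _)
  have hθκ' : κ' ≤ θ := ((le_max_right _ _).trans (le_max_left _ _)).trans (Order.le_succ _)
  have hreg : θ.IsRegular := Cardinal.isRegular_succ (le_max_right _ _)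
  obtain ⟨hgH, hordH, hclosed⟩ := hg θ hθκ'
  let Δ : H θ → H θ → Prop := WellOrderingRel
  have hne : Nonempty (HModel θ Δ) := ⟨(⟨g, hgH⟩ : H θ)⟩
  let M : Set Ordinal.{u} → Set ZFSet.{u} := fun p => hull θ Δ ({g} ∪ Ordinal.toZFSet '' p)
  have hMmono : Monotone M := fun p q hpq => hull_mono (union_subset_union_right _ (image_mono hpq))
  have hMcount : ∀ p : Set Ordinal.{u}, p.Countable → (M p).Countable := fun p hp =>
    countable_hull ((countable_singleton g).union (hp.image _))
  let K : Set Ordinal.{u} → Set Ordinal.{u} := fun p => ordTrace (M p) ω₁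
  obtain ⟨δ, hδ, W, hW0, hWK, hW⟩ := exists_splitting_family (K := K)
    (fun p q hpq α hα => ⟨hα.1, hMmono hpq hα.2⟩) (fun p α hα => hα.1)
    (fun p hp => countable_ordTrace (hMcount p hp) _)
  obtain ⟨β, ν, hν, hβν, hsup, hβW, hβR⟩ := StrongChang.exists_perfect_tree (R := R δ) hW0
    (fun p hp α hα => by
      obtain ⟨a, ha, b, hb, hab⟩ := hR δ hδ {β | β < ω_ 2 ∧ α < β ∧ insert β p ∈ W}
        (fun x hx => hx.1) (fun α' hα' => by
          obtain ⟨β, hβ, hlt, hβW⟩ := hW p hp (max α α') (max_lt hα hα')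
          exact ⟨β, ⟨hβ, (le_max_left _ _).trans_lt hlt, hβW⟩, (le_max_right _ _).trans_lt hlt⟩)
      exact ⟨a, b, ha.2.1, hb.2.1, ha.1, hb.1, hab, ha.2.2, hb.2.2⟩)
    -- The moves must lie above `ω₁`, where `g` codes `h`.
    (α₀ := ω₁) (Ordinal.omega_strictMono (by simp))
  have hB : ∀ x, ∃ B, (ν ≤ B ∧ B < ω_ 2) ∧ ∀ n, h (β x n) B < δ := by
    intro x
    have hβM : ∀ n, (β x n).toZFSet ∈ M (range (β x)) := fun n =>
      subset_hull (Or.inr ⟨_, ⟨n, rfl⟩, rfl⟩) (hordH _ ((hβν x n).2.trans hν))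
    have htrace : ordTrace (M (range (β x))) ω₁ ⊆ Iio δ := by
      intro α hα
      have hU : ({g} ∪ Ordinal.toZFSet '' range (β x) : Set ZFSet.{u}) =
          ⋃ n, ({g} ∪ Ordinal.toZFSet '' (β x '' Iio n)) := by
        rw [← union_iUnion, ← image_iUnion, ← image_iUnion]
        congr
        rw [← image_univ]
        congr 1
        exact (eq_univ_of_forall fun n => mem_iUnion.2 ⟨n + 1, mem_Iio.2 n.lt_succ_self⟩).symm
      have h1 := hα.2
      simp only [M] at h1
      rw [hU] at h1
      obtain ⟨n, hn⟩ := mem_hull_iUnion (fun m n hmn =>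
        union_subset_union_right _ (image_mono (image_mono (Iio_subset_Iio hmn)))) h1
      exact hWK _ (hβW x n) ⟨hα.1, hn⟩
    obtain ⟨N, hN, ⟨-, -, hMN, htr⟩, B, hBN, hsB⟩ := hκ θ hθκ hreg Δ inferInstance
      (M (range (β x))) (hMcount _ (countable_range _)) (isElementary_hull _)
    have hνB : ν ≤ B := by
      by_contra! hcon
      obtain ⟨n, hn⟩ := hsup x B hcon
      have h2 : β x n ≤ sSup (ordTrace (M (range (β x))) (ω_ 2)) :=
        le_csSup ⟨ω_ 2, fun α hα => hα.1.le⟩ ⟨(hβν x n).2.trans hν, hβM n⟩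
      exact (hn.trans_le (h2.trans hsB)).false
    refine ⟨B, ⟨hνB, hBN.1⟩, fun n => htrace ?_⟩
    have hlt : β x n < B := (hβν x n).2.trans_le hνB
    -- The value of `h` lies in `N` by closure, and below `ω₁` the models `N` and `M (range (β x))`
    -- agree.
    rw [htr]
    exact ⟨hh _ _ hlt hBN.1, hclosed Δ N hN
      (hMN.1 (subset_hull (Or.inl rfl) hgH)) _ _ (hβν x n).1.le hlt hBN.1 (hMN.1 (hβM n)) hBN.2⟩
  choose B hB hBh using hB
  exact ⟨δ, hδ, β, B, ν, hν, fun x n => (hβν x n).2, hB, hBh, hβR⟩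

theorem SCC.not_exists_special_aronszajn (not_CH : Cardinal.continuum.{u} ≠ ℵ₁)
    (hSCC : SCC.{u}) :
    ¬ ∃ (T : Type u) (_ : PartialOrder T) (_ : IsSetTree T), IsAronszajnTree T ∧ IsSpecial T := by
  rintro ⟨T, _, _, hT, hS⟩
  obtain ⟨e, f, he, hf, heinj, hfinj⟩ := hT.exists_labels hS
  have : Nonempty T := ⟨(hT.level_nonempty 0 (Ordinal.omega_pos 2)).some⟩
  choose! t ht using hT.level_nonempty
  have hs : ∀ α β : Ordinal.{u}, α ≤ β → β < ω_ 2 → ∃ s ≤ t β, nodeHeight s = α :=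
    fun α β hαβ hβ => exists_le_nodeHeight_eq (hαβ.trans (ht β hβ).ge)
  choose! s hst hs using hs
  obtain ⟨δ, hδ, β, B, ν, hν, hβν, hB, hBh, hR⟩ := hSCC.exists_perfect_tree
    (h := fun α β => max (e (s α β)) (f (s α β))) (fun α β _ _ => max_lt (he _) (hf _))
    (R := fun δ a b => a < b ∧ Conflict e f δ a b)
    (fun δ hδ U hU hunb => exists_conflict heinj hfinj hδ hU hunb)
  have hle : ∀ x n, s (β x n) (B x) ≤ s ν (B x) := fun x n => by
    have h1 := ((hβν x n).trans_le (hB x).1).le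
    refine le_of_nodeHeight_le (hst _ _ h1 (hB x).2) (hst _ _ (hB x).1 (hB x).2) ?_
    rw [hs _ _ h1 (hB x).2, hs _ _ (hB x).1 (hB x).2]
    exact (hβν x n).le
  have hheight : ∀ x n, nodeHeight (s (β x n) (B x)) = β x n := fun x n =>
    hs _ _ ((hβν x n).trans_le (hB x).1).le (hB x).2
  -- Below a common node on level `ν`, `s (β x n) (B x)` lies under `s (β y n) (B y)`. The upper
  -- node has label and the lower one colour below `δ`, against the conflict.
  have key : ∀ x y n, s ν (B x) = s ν (B y) →
      ¬ (β x n < β y n ∧ Conflict e f δ (β x n) (β y n)) := by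
    rintro x y n hxy ⟨hlt, hc⟩
    refine (hc _ (hheight y n) ((le_max_left _ _).trans_lt (hBh y n)) (s (β x n) (B x)) ?_
      (hheight x n)).not_gt ((le_max_right _ _).trans_lt (hBh x n))
    refine le_of_nodeHeight_le ((hle x n).trans hxy.le) (hle y n) ?_
    rw [hheight, hheight]
    exact hlt.le
  let F : (ℕ → Bool) → level T ν := fun x => ⟨s ν (B x), hs _ _ (hB x).1 (hB x).2⟩
  have hF : Function.Injective F := by
    intro x y hxy
    by_contra hne
    have hxy' : s ν (B x) = s ν (B y) := congrArg Subtype.val hxy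
    obtain ⟨n, hn | hn⟩ := hR x y hne
    · exact key x y n hxy' hn
    · exact key y x n hxy'.symm hn
  refine not_CH (le_antisymm ?_ Cardinal.aleph_one_le_continuum)
  have h1 := Cardinal.lift_mk_le_lift_mk_of_injective hF
  have h2 : Cardinal.lift.{u} #(ℕ → Bool) = Cardinal.continuum.{u} := by simp
  rw [h2, Cardinal.lift_id'.{0, u}] at h1
  exact h1.trans (hT.level_small ν hν)

end StrongChang

theorem mainTheorem10
    (not_CH : Cardinal.continuum.{u} ≠ Cardinal.aleph 1)
    (hSCC : StrongChang.SCC.{u}) :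
    ¬ ∃ (T : Type u) (_ : PartialOrder T) (_ : StrongChang.IsSetTree T),
      StrongChang.IsAronszajnTree T ∧ StrongChang.IsSpecial T :=
  hSCC.not_exists_special_aronszajn not_CH
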